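/- For positive integers $p,\ell,q$ let $A=R_x^{2\pi/p}$, $L=R_y^{2\pi/\ell}$ and $B=R_z^{2\pi/q}$ be the rotations of $\mathbb{R}^3$ about the $x$-, $y$- and $z$-axis by the angles $2\pi/p$, $2\pi/\ell$ and $2\pi/q$. Let $G(p,\ell,q)\subset SO(3)$ be the group generated by $A$, $L$ and $B$, and let $G(p,q)=G(p,1,q)$ be the group generated by $A$ and $B$. (i) If $p,q\ge 3$ are odd, then $G(p,q)$ is isomorphic to the free product $\mathbb{Z}_p*\mathbb{Z}_q=\langle \alpha,\beta : \alpha^p,\ \beta^q\rangle$. (ii) If $p\ge 4$ is even and $q\ge 3$ is odd, then $G(p,q)$ has the presentation $\langle \alpha,\beta : \alpha^p,\ \beta^q,\ \alpha^{p/2}\beta\alpha^{p/2}\beta\rangle$. (iii) If $p\ge 4$ is even and $q=2s$ with $s\ge 3$ odd, then $G(p,q)$ has the presentation $\langle \alpha,\beta : \alpha^p,\ \beta^q,\ \alpha^{p/2}\beta\alpha^{p/2}\beta,\ \beta^{q/2}\alpha\beta^{q/2}\alpha\rangle$. (iv) If $4$ divides both $p$ and $q$, then $G(p,1,q)=G(\operatorname{lcm}(p,q),4,1)$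 as subgroups of $SO(3)$. In cases (i), (ii) and (iii), the isomorphism between the abstract presentation and $G(p,q)$ is given by $\alpha\mapsto A$, $\beta\mapsto B$. -/

import Mathlib

open Real

noncomputable section

namespace RotGroup

/-- The group `SO(3)` of real orthogonal `3 × 3` matrices of determinant one. -/
abbrev SO3 : Type := Matrix.specialOrthogonalGroup (Fin 3) ℝ

/-- Rotation by the angle `θ` about the `x`-axis. -/
def rotX (θ : ℝ) : SO3 :=
  ⟨!![1, 0, 0; 0, cos θ, -sin θ; 0, sin θ, cos θ], by
    rw [Matrix.mem_specialOrthogonalGroup_iff, Matrix.mem_orthogonalGroup_iff]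
    have h := sin_sq_add_cos_sq θ
    constructor
    · ext i j
      fin_cases i <;> fin_cases j <;>
        simp [Matrix.mul_apply, Fin.sum_univ_three] <;> linarith
    · simp [Matrix.det_fin_three]
      linarith⟩

/-- Rotation by the angle `θ` about the `y`-axis. -/
def rotY (θ : ℝ) : SO3 :=
  ⟨!![cos θ, 0, sin θ; 0, 1, 0; -sin θ, 0, cos θ], by
    rw [Matrix.mem_specialOrthogonalGroup_iff, Matrix.mem_orthogonalGroup_iff]
    have h := sin_sq_add_cos_sq θ
    constructor
    · ext i j
      fin_cases i <;> fin_cases j <;>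
        simp [Matrix.mul_apply, Fin.sum_univ_three] <;> linarith
    · simp [Matrix.det_fin_three]
      linarith⟩

/-- Rotation by the angle `θ` about the `z`-axis. -/
def rotZ (θ : ℝ) : SO3 :=
  ⟨!![cos θ, -sin θ, 0; sin θ, cos θ, 0; 0, 0, 1], by
    rw [Matrix.mem_specialOrthogonalGroup_iff, Matrix.mem_orthogonalGroup_iff]
    have h := sin_sq_add_cos_sq θ
    constructor
    · ext i j
      fin_cases i <;> fin_cases j <;>
        simp [Matrix.mul_apply, Fin.sum_univ_three] <;> linarith
    · simp [Matrix.det_fin_three]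
      linarith⟩

/-- The generator `A`: rotation by `2π/p` about the `x`-axis. -/
def genA (p : ℕ) : SO3 := rotX (2 * π / p)

/-- The generator `L`: rotation by `2π/ℓ` about the `y`-axis. -/
def genL (l : ℕ) : SO3 := rotY (2 * π / l)

/-- The generator `B`: rotation by `2π/q` about the `z`-axis. -/
def genB (q : ℕ) : SO3 := rotZ (2 * π / q)

/-- `G(p,ℓ,q)`: the subgroup of `SO(3)` generated by `A`, `L` and `B`. -/
def G3 (p l q : ℕ) : Subgroup SO3 := Subgroup.closure {genA p, genL l, genB q}

/-- `G(p,q)`: the subgroup of `SO(3)` generated by `A` and `B`. -/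
def G (p q : ℕ) : Subgroup SO3 := Subgroup.closure {genA p, genB q}

theorem genL_one : genL 1 = 1 := by
  apply Subtype.ext
  ext i j
  fin_cases i <;> fin_cases j <;> simp [genL, rotY]

/-- `G(p,q)` is the same subgroup as `G(p,1,q)`. -/
theorem G3_one (p q : ℕ) : G3 p 1 q = G p q := by
  rw [G3, G, genL_one, Set.insert_comm, Subgroup.closure_insert_one]

/-- The free generator `α`. -/
def α : FreeGroup (Fin 2) := FreeGroup.of 0

/-- The free generator `β`. -/
def β : FreeGroup (Fin 2) := FreeGroup.of 1

/-- The relators `α^p, β^q`. -/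
def relsOdd (p q : ℕ) : Set (FreeGroup (Fin 2)) :=
  {α ^ p, β ^ q}

/-- The relators `α^p, β^q, α^(p/2) β α^(p/2) β` (used for even `p`). -/
def relsEvenOdd (p q : ℕ) : Set (FreeGroup (Fin 2)) :=
  {α ^ p, β ^ q, α ^ (p / 2) * β * α ^ (p / 2) * β}

/-- The relators `α^p, β^q, α^(p/2) β α^(p/2) β, β^(q/2) α β^(q/2) α`
(used for even `p` and `q`). -/
def relsEvenEven (p q : ℕ) : Set (FreeGroup (Fin 2)) :=
  {α ^ p, β ^ q, α ^ (p / 2) * β * α ^ (p / 2) * β, β ^ (q / 2) * α * β ^ (q / 2) * α}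

/-- `G(p,q)` has the presentation `⟨α, β : rels⟩`, by an isomorphism `α ↦ A`, `β ↦ B`. -/
def HasPresentation (p q : ℕ) (rels : Set (FreeGroup (Fin 2))) : Prop :=
  ∃ φ : PresentedGroup rels ≃* G p q,
    (φ (PresentedGroup.mk rels α) : SO3) = genA p ∧
    (φ (PresentedGroup.mk rels β) : SO3) = genB q

/-- `G(p,q)` is the free product `ℤ_p * ℤ_q`, by an isomorphism that sends the standard
generators of the two factors to `A` and `B`. -/
def IsFreeProduct (p q : ℕ) : Prop :=
  ∃ φ : Monoid.Coprod (Multiplicative (ZMod p)) (Multiplicative (ZMod q)) ≃* G p q,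
    (φ (Monoid.Coprod.inl (Multiplicative.ofAdd (1 : ZMod p))) : SO3) = genA p ∧
    (φ (Monoid.Coprod.inr (Multiplicative.ofAdd (1 : ZMod q))) : SO3) = genB q

end RotGroup

end

/-! Extend the 2-adic valuation to `ℂ`. A root of unity z with z² ≠ 1 satisfies v(2) < v(z - 1)
(`valuation_two_lt_sub_one`). Hence a rotation by a rational multiple of π that is not a multiple of
π/2 has cosine and sine of equal valuation > 1 (`one_lt_valuation_cos`, `valuation_sin_eq_cos`).
Such rotations about the x- and z-axes play ping-pong between two regions of `ℝ³` cut out by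
comparing the valuations of coordinates.

Quarter turns about the x-axis can join the game, those about the z-axis cannot; so (i)-(iii) allow
4 ∣ p but not 4 ∣ q. Half turns only change signs of coordinates. The relators make them a subgroup
V of the abstract group whose elements fix or invert each generator under conjugation. By
`mem_of_pingPong` the kernel of the map to `SO3` lies in V, where it is visibly trivial
(`injective_of_involutions`).

If 4 divides p and q, quarter turns about all three axes are available and interchange the axes, so
(iv) reduces to Bézout (`genA_lcm`). -/

namespace RotGroup

/-! ### Roots of unity and cosines under a 2-adic valuation. -/

section Valuation

variable {Γ₀ : Type*} [LinearOrderedCommGroupWithZero Γ₀]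

/-- The ideal (2) of the prime subring is proper, so some valuation ring of `ℂ` has it among its
nonunits. -/
theorem exists_valuation_two_lt_one :
    ∃ V : ValuationSubring ℂ, V.valuation 2 < 1 := by
  have h2 : (2 : ℂ) ∈ (⊥ : Subring ℂ) := Subring.mem_bot.2 ⟨2, by simp⟩
  have hne : Ideal.span {(⟨2, h2⟩ : (⊥ : Subring ℂ))} ≠ ⊤ := by
    rw [Ne, Ideal.eq_top_iff_one, Ideal.mem_span_singleton']
    rintro ⟨⟨a, ha⟩, h⟩
    obtain ⟨n, rfl⟩ := Subring.mem_bot.1 ha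
    have h' : (n : ℂ) * 2 = 1 := congrArg Subtype.val h
    have h'' : n * 2 = 1 := by exact_mod_cast h'
    omega
  obtain ⟨V, -, hV⟩ := Ideal.image_subset_nonunits_valuationSubring _ hne
  exact ⟨V, V.mem_nonunits_iff.1 (hV ⟨_, Ideal.subset_span rfl, rfl⟩)⟩

theorem valuation_eq_one_of_pow_eq_one (v : Valuation ℂ Γ₀) {z : ℂ} {n : ℕ} (hn : n ≠ 0)
    (hz : z ^ n = 1) : v z = 1 := by
  have h : v z ^ n = 1 := by rw [← map_pow, hz, map_one]
  exact (pow_eq_one_iff_of_nonneg zero_le hn).1 h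

theorem valuation_pow_sub_one_le (v : Valuation ℂ Γ₀) {z : ℂ} (hz : v z = 1) (k : ℕ) :
    v (z ^ k - 1) ≤ v (z - 1) := by
  rw [← geom_sum_mul, map_mul]
  refine mul_le_of_le_one_left' (v.map_sum_le fun i _ => ?_)
  rw [map_pow, hz, one_pow]

theorem valuation_natCast_odd (v : Valuation ℂ Γ₀) (h2 : v 2 < 1) {r : ℕ} (hr : Odd r) :
    v (r : ℂ) = 1 := by
  obtain ⟨k, rfl⟩ := hr
  have hk : v (k : ℂ) ≤ 1 := by
    simpa using v.map_sum_le (s := Finset.range k) (f := fun _ => (1 : ℂ)) (g := 1) (by simp)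
  have : v (2 * (k : ℂ)) < 1 := by
    rw [map_mul]
    exact mul_lt_one_of_lt_of_le h2 hk
  push_cast
  rw [add_comm]
  exact v.map_one_add_of_lt this

/-- If v(z - 1) ≤ v(2), the same bound passes to every power t of z. Since z has order > 2, some t
has order 4 or odd prime order r. In the first case (t - 1)² = -2t gives v(2) ≤ v(2)²; in the
second, t ≡ 1 turns 1 + t + ⋯ + t^(r-1) = 0 into v(r) < 1, although r is odd. -/
theorem valuation_two_lt_sub_one (v : Valuation ℂ Γ₀) (h2 : v 2 < 1) {z : ℂ} {n : ℕ}
    (hn : 0 < n) (hz : z ^ n = 1) (hz2 : z ^ 2 ≠ 1) : v 2 < v (z - 1) := by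
  by_contra! hle
  have hvz := valuation_eq_one_of_pow_eq_one v hn.ne' hz
  have hfin : 0 < orderOf z := orderOf_pos_iff.2 (isOfFinOrder_iff_pow_eq_one.2 ⟨n, hn, hz⟩)
  have h2lt : 2 < orderOf z := by
    by_contra! h
    apply hz2
    rw [← orderOf_dvd_iff_pow_eq_one]
    interval_cases orderOf z <;> norm_num
  obtain h4 | ⟨r, hr, hrd, hodd⟩ := Nat.four_dvd_or_exists_odd_prime_and_dvd_of_two_lt h2lt
  · set t := z ^ (orderOf z / 4) with ht
    have ho : orderOf t = 4 := orderOf_pow_orderOf_div hfin.ne' h4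
    have ht4 : t ^ 4 = 1 := ho ▸ pow_orderOf_eq_one t
    have ht2 : t ^ 2 ≠ 1 := by
      rw [Ne, ← orderOf_dvd_iff_pow_eq_one, ho]; norm_num
    have hneg : t ^ 2 = -1 := by
      have : (t ^ 2 - 1) * (t ^ 2 + 1) = 0 := by linear_combination ht4
      exact eq_neg_of_add_eq_zero_left ((mul_eq_zero.1 this).resolve_left (sub_ne_zero.2 ht2))
    have hvt : v t = 1 := valuation_eq_one_of_pow_eq_one v four_ne_zero ht4
    have hsq : v (t - 1) ^ 2 = v 2 := by
      rw [← map_pow, show (t - 1) ^ 2 = -(2 * t) by linear_combination hneg, v.map_neg, map_mul,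
        hvt, mul_one]
    have hle' : v (t - 1) ≤ v 2 := (valuation_pow_sub_one_le v hvz _).trans hle
    have h20 : 0 < v 2 := zero_lt_iff.2 (v.ne_zero_iff.2 two_ne_zero)
    have : v 2 ^ 2 < v 2 := by
      rw [sq]; exact mul_lt_of_lt_one_left h20 h2
    exact absurd (hsq ▸ pow_le_pow_left' hle' 2) this.not_ge
  · set t := z ^ (orderOf z / r) with ht
    have ho : orderOf t = r := orderOf_pow_orderOf_div hfin.ne' hrd
    have htr : t ^ r = 1 := ho ▸ pow_orderOf_eq_one t
    have ht1 : t ≠ 1 := fun h => hr.one_lt.ne' (by rw [← ho, h, orderOf_one])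
    have hvt : v t = 1 := valuation_eq_one_of_pow_eq_one v hr.ne_zero htr
    have hlt : v (t - 1) < 1 := ((valuation_pow_sub_one_le v hvz _).trans hle).trans_lt h2
    have hsum : ∑ i ∈ Finset.range r, t ^ i = 0 := by
      have := geom_sum_mul t r
      rw [htr, sub_self] at this
      exact (mul_eq_zero.1 this).resolve_right (sub_ne_zero.2 ht1)
    have hr' : (r : ℂ) = -∑ i ∈ Finset.range r, (t ^ i - 1) := by
      rw [Finset.sum_sub_distrib, hsum]; simp
    have hvr : v (r : ℂ) < 1 := by
      rw [hr', v.map_neg]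
      exact v.map_sum_lt one_ne_zero fun i _ => (valuation_pow_sub_one_le v hvt i).trans_lt hlt
    exact hvr.ne (valuation_natCast_odd v h2 hodd)

/-- With z = exp(iθ), 2 cos θ = z + z⁻¹ equals w - 1 up to a unit, for the root of unity w = -z². -/
theorem one_lt_valuation_cos (v : Valuation ℂ Γ₀) (h2 : v 2 < 1) {θ : ℝ} {n : ℕ} (hn : 0 < n)
    (hθ : Complex.exp (θ * Complex.I) ^ n = 1) (hs : sin (2 * θ) ≠ 0) :
    1 < v (cos θ : ℂ) := by
  set z := Complex.exp (θ * Complex.I) with hz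
  have hz0 : z ≠ 0 := Complex.exp_ne_zero _
  have hcos : (2 : ℂ) * (cos θ : ℂ) = -(z⁻¹ * (-z ^ 2 - 1)) := by
    have : z⁻¹ = Complex.exp (-θ * Complex.I) := by rw [hz, ← Complex.exp_neg]; ring_nf
    rw [Complex.ofReal_cos, Complex.two_cos, ← this, ← hz]
    field_simp
    ring
  -- The exponent is doubled to absorb the sign.
  have hw : (-z ^ 2) ^ (2 * n) = 1 := by
    rw [neg_pow, ← pow_mul, show 2 * (2 * n) = n * 4 by ring, pow_mul z, hθ]
    simp
  have hw2 : (-z ^ 2) ^ 2 ≠ 1 := by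
    intro h
    apply hs
    have h4 : Complex.exp ((2 * θ : ℝ) * Complex.I) ^ 2 = 1 := by
      rw [← h, hz, neg_sq, ← pow_mul, ← Complex.exp_nat_mul, ← Complex.exp_nat_mul]
      congr 1; push_cast; ring
    rcases sq_eq_sq_iff_eq_or_eq_neg.1 (h4.trans (one_pow 2).symm) with h | h
    · have := congrArg Complex.im h
      rw [Complex.exp_ofReal_mul_I_im] at this
      simpa using this
    · have := congrArg Complex.im h
      rw [Complex.exp_ofReal_mul_I_im] at this
      simpa using this
  have hlt := valuation_two_lt_sub_one v h2 (by omega) hw hw2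
  have hvz := valuation_eq_one_of_pow_eq_one v hn.ne' hθ
  have hv := congrArg v hcos
  rw [v.map_neg, map_mul, map_mul, map_inv₀, hvz, inv_one, one_mul] at hv
  by_contra! hc
  exact absurd (hv ▸ hlt) (mul_le_of_le_one_right' hc).not_gt

theorem valuation_sin_eq_cos (v : Valuation ℝ Γ₀) {θ : ℝ} (hc : 1 < v (cos θ)) :
    v (sin θ) = v (cos θ) := by
  have h1 : 1 < v (cos θ ^ 2) := by rw [map_pow]; exact one_lt_pow₀ hc two_ne_zero
  have h : v (sin θ) ^ 2 = v (cos θ) ^ 2 := by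
    rw [← map_pow, sin_sq, ← map_pow]
    exact v.map_sub_eq_of_lt_right (by simpa using h1)
  exact (pow_left_inj₀ zero_le zero_le two_ne_zero).1 h

end Valuation

/-! ### Ping-pong relative to a subgroup. -/

section PingPong

variable {Γ X P : Type*} [Group Γ]

/-- Alternating products of powers of two elements `x true`, `x false` which avoid the
subgroup `V`, with a last factor in `V`; the first index records the leading letter. -/
inductive AltWord (x : Bool → Γ) (V : Subgroup Γ) : Bool → Γ → Prop
  | single (t : Bool) (i : ℤ) (h : Γ) : x t ^ i ∉ V → h ∈ V → AltWord x V t (x t ^ i * h)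
  | cons (t : Bool) (i : ℤ) (h : Γ) : x t ^ i ∉ V → AltWord x V (!t) h →
      AltWord x V t (x t ^ i * h)

theorem exists_zpow_mul_of_conj {x v : Γ} {V : Subgroup Γ} (hv : v * x * v⁻¹ = x ∨ v * x * v⁻¹ = x⁻¹)
    {i : ℤ} (hi : x ^ i ∉ V) : ∃ j : ℤ, x ^ j ∉ V ∧ v * x ^ i = x ^ j * v := by
  rcases hv with hv | hv
  · refine ⟨i, hi, ?_⟩
    rw [← mul_inv_eq_iff_eq_mul, ← conj_zpow, hv]
  · refine ⟨-i, by rwa [zpow_neg, inv_mem_iff], ?_⟩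
    rw [← mul_inv_eq_iff_eq_mul, ← conj_zpow, hv, inv_zpow, zpow_neg]

/-- An element of V moves rightwards past each syllable, at most inverting it, and is absorbed by
the last factor. -/
theorem AltWord.mul_left {x : Bool → Γ} {V : Subgroup Γ}
    (hconj : ∀ v ∈ V, ∀ t, v * x t * v⁻¹ = x t ∨ v * x t * v⁻¹ = (x t)⁻¹)
    {t : Bool} {g : Γ} (hg : AltWord x V t g) {v : Γ} (hv : v ∈ V) : AltWord x V t (v * g) := by
  induction hg with
  | single t i h hi hh =>
    obtain ⟨j, hj, e⟩ := exists_zpow_mul_of_conj (hconj v hv t) hi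
    rw [← mul_assoc, e, mul_assoc]
    exact .single _ _ _ hj (V.mul_mem hv hh)
  | cons t i h hi hh ih =>
    obtain ⟨j, hj, e⟩ := exists_zpow_mul_of_conj (hconj v hv t) hi
    rw [← mul_assoc, e, mul_assoc]
    exact .cons _ _ _ hj ih

theorem mem_or_altWord_zpow_mul {x : Bool → Γ} {V : Subgroup Γ}
    (hconj : ∀ v ∈ V, ∀ t, v * x t * v⁻¹ = x t ∨ v * x t * v⁻¹ = (x t)⁻¹)
    (t : Bool) (i : ℤ) {g : Γ} (hg : g ∈ V ∨ ∃ s, AltWord x V s g) :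
    x t ^ i * g ∈ V ∨ ∃ s, AltWord x V s (x t ^ i * g) := by
  by_cases hi : x t ^ i ∈ V
  · exact hg.imp (V.mul_mem hi) fun ⟨s, hs⟩ => ⟨s, hs.mul_left hconj hi⟩
  obtain hg | ⟨s, hs⟩ := hg
  · exact .inr ⟨t, .single _ _ _ hi hg⟩
  by_cases hst : s = !t
  · exact .inr ⟨t, .cons _ _ _ hi (hst ▸ hs)⟩
  obtain rfl : s = t := by revert hst; cases s <;> cases t <;> simp
  cases hs with
  | single _ j h hj hh =>
    rw [← mul_assoc, ← zpow_add]
    by_cases hij : x s ^ (i + j) ∈ V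
    · exact .inl (V.mul_mem hij hh)
    · exact .inr ⟨s, .single _ _ _ hij hh⟩
  | cons _ j h hj hh =>
    rw [← mul_assoc, ← zpow_add]
    by_cases hij : x s ^ (i + j) ∈ V
    · exact .inr ⟨_, hh.mul_left hconj hij⟩
    · exact .inr ⟨s, .cons _ _ _ hij hh⟩

theorem mem_or_altWord {x : Bool → Γ} {V : Subgroup Γ}
    (hconj : ∀ v ∈ V, ∀ t, v * x t * v⁻¹ = x t ∨ v * x t * v⁻¹ = (x t)⁻¹)
    (hx : Subgroup.closure (Set.range x) = ⊤) (g : Γ) : g ∈ V ∨ ∃ s, AltWord x V s g := by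
  have hg : g ∈ Subgroup.closure (Set.range x) := hx ▸ Subgroup.mem_top g
  induction hg using Subgroup.closure_induction_left with
  | one => exact .inl V.one_mem
  | mul_left y hy g _ ih =>
    obtain ⟨t, rfl⟩ := hy
    simpa using mem_or_altWord_zpow_mul hconj t 1 ih
  | inv_mul_cancel y hy g _ ih =>
    obtain ⟨t, rfl⟩ := hy
    simpa using mem_or_altWord_zpow_mul hconj t (-1) ih

/-- A ping-pong lemma for amalgams: powers of `x true` outside `V` play from `Y false` to `Y true`
without decreasing the size `N`, powers of `x false` outside `V` play back and increase it. -/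
theorem mem_of_pingPong [LinearOrder P] (ρ : Γ → X → X)
    (hρ : ∀ g h w, ρ (g * h) w = ρ g (ρ h w)) (N : X → P)
    (Y : Bool → Set X) (hY : Disjoint (Y true) (Y false)) (hne : ∀ t, (Y t).Nonempty)
    (x : Bool → Γ) (V : Subgroup Γ)
    (hconj : ∀ v ∈ V, ∀ t, v * x t * v⁻¹ = x t ∨ v * x t * v⁻¹ = (x t)⁻¹)
    (hx : Subgroup.closure (Set.range x) = ⊤)
    (hV : ∀ v ∈ V, ∀ w, N (ρ v w) = N w ∧ ∀ t, w ∈ Y t → ρ v w ∈ Y t)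
    (htrue : ∀ i : ℤ, x true ^ i ∉ V → ∀ w ∈ Y false,
      ρ (x true ^ i) w ∈ Y true ∧ N w ≤ N (ρ (x true ^ i) w))
    (hfalse : ∀ i : ℤ, x false ^ i ∉ V → ∀ w ∈ Y true,
      ρ (x false ^ i) w ∈ Y false ∧ N w < N (ρ (x false ^ i) w))
    {g : Γ} (hg : ∀ w, ρ g w = w) : g ∈ V := by
  -- The size grows strictly as soon as a syllable of `x false` occurs. The second alternative
  -- serves words with a single syllable, of `x true`: there w is not fixed because it changes
  -- region.
  have key : ∀ t g, AltWord x V t g → ∃ w, ρ g w ∈ Y t ∧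
      (N w < N (ρ g w) ∨ t = true ∧ N w ≤ N (ρ g w) ∧ w ∉ Y t) := by
    intro t g hg
    induction hg with
    | single t i h hi hh =>
      obtain ⟨w, hw⟩ := hne (!t)
      obtain ⟨hN, hYw⟩ := hV h hh w
      refine ⟨w, ?_⟩
      rw [hρ]
      cases t
      · have := hfalse i hi _ (hYw _ hw)
        exact ⟨this.1, .inl (hN ▸ this.2)⟩
      · have := htrue i hi _ (hYw _ hw)
        exact ⟨this.1, .inr ⟨rfl, hN ▸ this.2, fun h' => Set.disjoint_left.1 hY h' hw⟩⟩
    | cons t i h hi hh ih =>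
      obtain ⟨w, hw, hN⟩ := ih
      refine ⟨w, ?_⟩
      rw [hρ]
      cases t
      · have := hfalse i hi _ hw
        exact ⟨this.1, .inl ((hN.elim le_of_lt fun h => h.2.1).trans_lt this.2)⟩
      · have := htrue i hi _ hw
        -- The tail starts with `x false`, so it already gives strict growth.
        exact ⟨this.1, .inl ((hN.resolve_right (by simp)).trans_le this.2)⟩
  refine (mem_or_altWord hconj hx g).resolve_right ?_
  rintro ⟨t, ht⟩
  obtain ⟨w, hw, h⟩ := key t g ht
  rw [hg] at hw h
  rcases h with h | ⟨-, -, h⟩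
  · exact lt_irrefl _ h
  · exact h hw

end PingPong

/-! ### Relations between rotations about the coordinate axes. -/

section Rotations

theorem rotX_add (s t : ℝ) : rotX (s + t) = rotX s * rotX t := by
  apply Subtype.ext
  ext i j
  fin_cases i <;> fin_cases j <;>
    simp [rotX, cos_add, sin_add] <;> ring

theorem rotZ_add (s t : ℝ) : rotZ (s + t) = rotZ s * rotZ t := by
  apply Subtype.ext
  ext i j
  fin_cases i <;> fin_cases j <;>
    simp [rotZ, cos_add, sin_add] <;> ring

theorem rotX_zero : rotX 0 = 1 := by
  apply Subtype.ext
  ext i j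
  fin_cases i <;> fin_cases j <;> simp [rotX]

theorem rotZ_zero : rotZ 0 = 1 := by
  apply Subtype.ext
  ext i j
  fin_cases i <;> fin_cases j <;> simp [rotZ]

/-- `rotX` as a homomorphism. -/
noncomputable def rotXHom : Multiplicative ℝ →* SO3 where
  toFun θ := rotX θ.toAdd
  map_one' := rotX_zero
  map_mul' s t := rotX_add s.toAdd t.toAdd

/-- `rotZ` as a homomorphism. -/
noncomputable def rotZHom : Multiplicative ℝ →* SO3 where
  toFun θ := rotZ θ.toAdd
  map_one' := rotZ_zero
  map_mul' s t := rotZ_add s.toAdd t.toAdd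

theorem rotX_zpow (θ : ℝ) (n : ℤ) : rotX θ ^ n = rotX (n * θ) := by
  have h := map_zpow rotXHom (Multiplicative.ofAdd θ) n
  rw [← ofAdd_zsmul, zsmul_eq_mul] at h
  exact h.symm

theorem rotZ_zpow (θ : ℝ) (n : ℤ) : rotZ θ ^ n = rotZ (n * θ) := by
  have h := map_zpow rotZHom (Multiplicative.ofAdd θ) n
  rw [← ofAdd_zsmul, zsmul_eq_mul] at h
  exact h.symm

theorem rotX_two_pi : rotX (2 * π) = 1 := by
  apply Subtype.ext
  ext i j
  fin_cases i <;> fin_cases j <;> simp [rotX]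

theorem rotZ_two_pi : rotZ (2 * π) = 1 := by
  apply Subtype.ext
  ext i j
  fin_cases i <;> fin_cases j <;> simp [rotZ]

theorem genA_zpow (p : ℕ) (n : ℤ) : genA p ^ n = rotX (n * (2 * π / p)) := rotX_zpow _ _

theorem genB_zpow (q : ℕ) (n : ℤ) : genB q ^ n = rotZ (n * (2 * π / q)) := rotZ_zpow _ _

theorem genA_pow_self {p : ℕ} (hp : p ≠ 0) : genA p ^ p = 1 := by
  rw [← zpow_natCast, genA_zpow, ← rotX_two_pi]
  congr 1
  push_cast
  field_simp

theorem genB_pow_self {q : ℕ} (hq : q ≠ 0) : genB q ^ q = 1 := by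
  rw [← zpow_natCast, genB_zpow, ← rotZ_two_pi]
  congr 1
  push_cast
  field_simp

theorem genA_pow_half {p : ℕ} (hp : p ≠ 0) (he : Even p) : genA p ^ (p / 2) = rotX π := by
  obtain ⟨k, rfl⟩ := he
  have hk : (k : ℝ) ≠ 0 := by
    rintro h; apply hp; have : k = 0 := by exact_mod_cast h
    omega
  rw [← zpow_natCast, genA_zpow]
  congr 1
  rw [show (k + k) / 2 = k by omega]
  push_cast
  field_simp
  ring

theorem genB_pow_half {q : ℕ} (hq : q ≠ 0) (he : Even q) : genB q ^ (q / 2) = rotZ π := by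
  obtain ⟨k, rfl⟩ := he
  have hk : (k : ℝ) ≠ 0 := by
    rintro h; apply hq; have : k = 0 := by exact_mod_cast h
    omega
  rw [← zpow_natCast, genB_zpow]
  congr 1
  rw [show (k + k) / 2 = k by omega]
  push_cast
  field_simp
  ring

theorem rotX_pi_mul_rotZ (θ : ℝ) : rotX π * rotZ θ * rotX π * rotZ θ = 1 := by
  have h := sin_sq_add_cos_sq θ
  apply Subtype.ext
  ext i j
  fin_cases i <;> fin_cases j <;>
    simp [rotX, rotZ] <;> linarith

theorem rotZ_pi_mul_rotX (θ : ℝ) : rotZ π * rotX θ * rotZ π * rotX θ = 1 := by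
  have h := sin_sq_add_cos_sq θ
  apply Subtype.ext
  ext i j
  fin_cases i <;> fin_cases j <;>
    simp [rotX, rotZ] <;> linarith

theorem rotX_mulVec (θ : ℝ) (w : Fin 3 → ℝ) :
    (rotX θ).1.mulVec w =
      ![w 0, cos θ * w 1 - sin θ * w 2, sin θ * w 1 + cos θ * w 2] := by
  ext i
  fin_cases i <;> simp [rotX, Matrix.mulVec, dotProduct, Fin.sum_univ_three]; ring

theorem rotZ_mulVec (θ : ℝ) (w : Fin 3 → ℝ) :
    (rotZ θ).1.mulVec w =
      ![cos θ * w 0 - sin θ * w 1, sin θ * w 0 + cos θ * w 1, w 2] := by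
  ext i
  fin_cases i <;> simp [rotZ, Matrix.mulVec, dotProduct, Fin.sum_univ_three]; ring

end Rotations

/-! ### The two regions and how rotations move them. -/

section Regions

variable {Γ₀ : Type*} [LinearOrderedCommGroupWithZero Γ₀] (v : Valuation ℝ Γ₀)

/-- The largest valuation of a coordinate. -/
noncomputable def size (w : Fin 3 → ℝ) : Γ₀ := max (max (v (w 0)) (v (w 1))) (v (w 2))

/-- `region v true` contains the vectors reached by rotations about the `x`-axis and
`region v false` those reached by rotations about the `z`-axis. -/
def region : Bool → Set (Fin 3 → ℝ)
  | true => {w | max (v (w 0)) (v (w 1)) = v (w 2) ∧ v (w 0) ≠ v (w 1)}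
  | false => {w | v (w 0) = v (w 1) ∧ v (w 2) < v (w 1)}

theorem disjoint_region : Disjoint (region v true) (region v false) :=
  Set.disjoint_left.2 fun _ h h' => h.2 h'.1

theorem region_nonempty (t : Bool) : (region v t).Nonempty := by
  cases t
  · exact ⟨![1, 1, 0], by simp [region]⟩
  · exact ⟨![1, 0, 1], by simp [region]⟩

variable {v}

/-- Sine and cosine have the same valuation, so the `w 1` term dominates in both new coordinates,
which then outweigh the unchanged `w 0`. -/
theorem rotX_mulVec_of_generic {θ : ℝ} (hc : 1 < v (cos θ)) {w : Fin 3 → ℝ}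
    (hw : w ∈ region v false) :
    (rotX θ).1.mulVec w ∈ region v true ∧ size v w ≤ size v ((rotX θ).1.mulVec w) := by
  obtain ⟨h01, h21⟩ := hw
  have hs := valuation_sin_eq_cos v hc
  have hc0 : 0 < v (cos θ) := zero_lt_one.trans hc
  have h1 : v (cos θ * w 1 - sin θ * w 2) = v (cos θ) * v (w 1) := by
    rw [v.map_sub_eq_of_lt_left, map_mul]
    rw [map_mul, map_mul, hs]
    exact mul_lt_mul_of_pos_left h21 hc0
  have h2 : v (sin θ * w 1 + cos θ * w 2) = v (cos θ) * v (w 1) := by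
    rw [v.map_add_eq_of_lt_left, map_mul, hs]
    rw [map_mul, map_mul, hs]
    exact mul_lt_mul_of_pos_left h21 hc0
  have hlt : v (w 1) < v (cos θ) * v (w 1) :=
    lt_mul_of_one_lt_left (zero_le.trans_lt h21) hc
  rw [rotX_mulVec]
  simp [region, size, h1, h2, h01, hlt.le, hlt.ne, h21.le.trans hlt.le]

/-- Up to sign, a quarter turn swaps the last two coordinates. The size does not grow, hence the
weak inequality on the x-side. -/
theorem rotX_mulVec_of_quarter {θ : ℝ} (hc : cos θ = 0) {w : Fin 3 → ℝ}
    (hw : w ∈ region v false) :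
    (rotX θ).1.mulVec w ∈ region v true ∧ size v w ≤ size v ((rotX θ).1.mulVec w) := by
  obtain ⟨h01, h21⟩ := hw
  have hs : v (sin θ) = 1 := by
    have h : v (sin θ) ^ 2 = 1 := by rw [← map_pow, sin_sq, hc]; simp
    exact (pow_eq_one_iff_of_nonneg zero_le two_ne_zero).1 h
  rw [rotX_mulVec]
  simp [region, size, h01, hc, hs, h21.le, h21.ne']

/-- The first two coordinates have different valuations, so no cancellation occurs: both new ones
are as large as the bigger old one times cos θ. -/
theorem rotZ_mulVec_of_generic {θ : ℝ} (hc : 1 < v (cos θ)) {w : Fin 3 → ℝ}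
    (hw : w ∈ region v true) :
    (rotZ θ).1.mulVec w ∈ region v false ∧ size v w < size v ((rotZ θ).1.mulVec w) := by
  obtain ⟨hmax, hne⟩ := hw
  have hs := valuation_sin_eq_cos v hc
  have hc0 : 0 < v (cos θ) := zero_lt_one.trans hc
  have h0 : v (cos θ * w 0 - sin θ * w 1) = v (cos θ) * v (w 2) := by
    rw [← hmax]
    rcases lt_or_gt_of_ne hne with h | h
    · rw [v.map_sub_eq_of_lt_right, map_mul, hs, max_eq_right h.le]
      rw [map_mul, map_mul, hs]
      exact mul_lt_mul_of_pos_left h hc0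
    · rw [v.map_sub_eq_of_lt_left, map_mul, max_eq_left h.le]
      rw [map_mul, map_mul, hs]
      exact mul_lt_mul_of_pos_left h hc0
  have h1 : v (sin θ * w 0 + cos θ * w 1) = v (cos θ) * v (w 2) := by
    rw [← hmax]
    rcases lt_or_gt_of_ne hne with h | h
    · rw [v.map_add_eq_of_lt_right, map_mul, max_eq_right h.le]
      rw [map_mul, map_mul, hs]
      exact mul_lt_mul_of_pos_left h hc0
    · rw [v.map_add_eq_of_lt_left, map_mul, hs, max_eq_left h.le]
      rw [map_mul, map_mul, hs]
      exact mul_lt_mul_of_pos_left h hc0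
  have hpos : 0 < v (w 2) := by
    rw [← hmax]
    rcases lt_or_gt_of_ne hne with h | h
    · exact lt_max_of_lt_right (zero_le.trans_lt h)
    · exact lt_max_of_lt_left (zero_le.trans_lt h)
  have hlt : v (w 2) < v (cos θ) * v (w 2) := lt_mul_of_one_lt_left hpos hc
  rw [rotZ_mulVec]
  simp [region, size, h0, h1, hmax, hlt]

theorem region_size_of_abs_eq {w w' : Fin 3 → ℝ} (h : ∀ i, |w' i| = |w i|) :
    size v w' = size v w ∧ ∀ t, w ∈ region v t → w' ∈ region v t := by
  have hv : ∀ i, v (w' i) = v (w i) := fun i => by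
    rcases abs_eq_abs.1 (h i) with h | h <;> simp [h, v.map_neg]
  refine ⟨by simp [size, hv], fun t => ?_⟩
  cases t <;> simp [region, hv]

end Regions

/-! ### From ping-pong to faithfulness. -/

section Injectivity

variable {Γ : Type*} [Group Γ]

theorem exp_pow_eq_one {p : ℕ} (hp : p ≠ 0) (i : ℤ) :
    Complex.exp ((i * (2 * π / p) : ℝ) * Complex.I) ^ p = 1 := by
  rw [← Complex.exp_nat_mul, Complex.exp_eq_one_iff]
  refine ⟨i, ?_⟩
  have : (p : ℂ) ≠ 0 := by exact_mod_cast hp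
  push_cast
  field_simp

theorem dvd_of_sin_eq_zero {p m : ℕ} (hp : p ≠ 0) {i : ℤ}
    (h : sin (m * (i * (2 * π / p))) = 0) : (p : ℤ) ∣ 2 * m * i := by
  obtain ⟨n, hn⟩ := sin_eq_zero_iff.1 h
  have hp' : (p : ℝ) ≠ 0 := by exact_mod_cast hp
  have : (n * p : ℝ) = 2 * m * i := by
    field_simp at hn
    linarith
  exact ⟨n, by rw [mul_comm (p : ℤ)]; exact_mod_cast this.symm⟩

/-- `hA` puts into V the powers of a with angle in πℤ; `hB` those of b with angle in (π/2)ℤ, since a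
quarter turn about z has no ping-pong move. -/
theorem injective_of_subgroup (φ : Γ →* SO3) {a b : Γ} {p q : ℕ} (hp : p ≠ 0) (hq : q ≠ 0)
    (ha : φ a = genA p) (hb : φ b = genB q) (hab : Subgroup.closure {a, b} = ⊤)
    (V : Subgroup Γ)
    (hVa : ∀ v ∈ V, v * a * v⁻¹ = a ∨ v * a * v⁻¹ = a⁻¹)
    (hVb : ∀ v ∈ V, v * b * v⁻¹ = b ∨ v * b * v⁻¹ = b⁻¹)
    (hVabs : ∀ v ∈ V, ∀ w i, |(φ v).1.mulVec w i| = |w i|)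
    (hVinj : ∀ v ∈ V, φ v = 1 → v = 1)
    (hA : ∀ i : ℤ, (p : ℤ) ∣ 2 * i → a ^ i ∈ V)
    (hB : ∀ i : ℤ, (q : ℤ) ∣ 4 * i → b ^ i ∈ V) : Function.Injective φ := by
  obtain ⟨W, hW⟩ := exists_valuation_two_lt_one
  set v : Valuation ℝ W.ValueGroup := W.valuation.comap (algebraMap ℝ ℂ) with hv
  have hcos : ∀ {n : ℕ} (_ : n ≠ 0) (i : ℤ), sin (2 * (i * (2 * π / n))) ≠ 0 →
      1 < v (cos (i * (2 * π / n))) := fun {n} hn i hs =>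
    one_lt_valuation_cos W.valuation hW (Nat.pos_of_ne_zero hn) (exp_pow_eq_one hn i) hs
  rw [injective_iff_map_eq_one]
  intro g hg
  refine hVinj g ?_ hg
  refine mem_of_pingPong (fun g w => (φ g).1.mulVec w) ?_ (size v) (region v) (disjoint_region v)
    (region_nonempty v) (fun t => cond t a b) V ?_ ?_ ?_ ?_ ?_ ?_
  · intro g h w
    simp [Matrix.mulVec_mulVec]
  · intro v hv t
    cases t
    · exact hVb v hv
    · exact hVa v hv
  · rw [← hab]
    congr 1
    ext x
    simp [or_comm, eq_comm]
  · exact fun u hu w => region_size_of_abs_eq fun i => hVabs u hu w i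
  · intro i hi w hw
    have hs1 : sin (i * (2 * π / p)) ≠ 0 := fun h => hi <| hA i <| by
      simpa using dvd_of_sin_eq_zero (m := 1) hp (by simpa using h)
    simp only [cond_true, map_zpow, ha, genA_zpow]
    -- As sin θ ≠ 0, vanishing of sin 2θ leaves exactly the quarter turns.
    by_cases hs : sin (2 * (i * (2 * π / p))) = 0
    · refine rotX_mulVec_of_quarter ?_ hw
      rw [sin_two_mul] at hs
      simpa [hs1] using hs
    · exact rotX_mulVec_of_generic (hcos hp i hs) hw
  · intro i hi w hw
    simp only [cond_false, map_zpow, hb, genB_zpow]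
    refine rotZ_mulVec_of_generic (hcos hq i fun h => hi <| hB i ?_) hw
    simpa [mul_assoc] using dvd_of_sin_eq_zero (m := 2) hq (by simpa using h)
  · intro w
    simp [hg]

/-- The subgroup `{1, s, t, st}` generated by two commuting involutions. -/
def kleinSubgroup (s t : Γ) (hs : s * s = 1) (ht : t * t = 1) (hst : s * t = t * s) :
    Subgroup Γ where
  carrier := {1, s, t, s * t}
  one_mem' := by simp
  mul_mem' := by
    have h1 : ∀ x, s * (s * x) = x := fun x => by rw [← mul_assoc, hs, one_mul]
    have h3 : ∀ x, t * (s * x) = s * (t * x) := fun x => by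
      rw [← mul_assoc, ← hst, mul_assoc]
    rintro x y (rfl | rfl | rfl | rfl) (rfl | rfl | rfl | rfl) <;>
      simp [mul_assoc, h1, h3, hs, ht, ← hst]
  inv_mem' := by
    have hs' : s⁻¹ = s := inv_eq_of_mul_eq_one_left hs
    have ht' : t⁻¹ = t := inv_eq_of_mul_eq_one_left ht
    rintro x (rfl | rfl | rfl | rfl) <;> simp [hs', ht', ← hst]

theorem conj_mul_eq_or {x s t : Γ} (hs : s * x * s⁻¹ = x ∨ s * x * s⁻¹ = x⁻¹)
    (ht : t * x * t⁻¹ = x ∨ t * x * t⁻¹ = x⁻¹) :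
    s * t * x * (s * t)⁻¹ = x ∨ s * t * x * (s * t)⁻¹ = x⁻¹ := by
  have e : s * t * x * (s * t)⁻¹ = s * (t * x * t⁻¹) * s⁻¹ := by group
  have hs' : s * x⁻¹ * s⁻¹ = (s * x * s⁻¹)⁻¹ := by group
  rw [e]
  rcases ht with ht | ht <;> rw [ht] <;> rcases hs with hs | hs <;> simp [hs', hs]

theorem abs_rotX_pi_mulVec (w : Fin 3 → ℝ) (i : Fin 3) :
    |(rotX π).1.mulVec w i| = |w i| := by
  rw [rotX_mulVec]
  fin_cases i <;> simp

theorem abs_rotZ_pi_mulVec (w : Fin 3 → ℝ) (i : Fin 3) :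
    |(rotZ π).1.mulVec w i| = |w i| := by
  rw [rotZ_mulVec]
  fin_cases i <;> simp

theorem rotX_pi_ne_one : rotX π ≠ 1 := fun h => by
  have := congrArg (fun M : SO3 => M.1 1 1) h
  simp [rotX] at this
  linarith

theorem rotZ_pi_ne_one : rotZ π ≠ 1 := fun h => by
  have := congrArg (fun M : SO3 => M.1 0 0) h
  simp [rotZ] at this
  linarith

theorem rotZ_pi_mul_rotX_pi_ne_one : rotZ π * rotX π ≠ 1 := fun h => by
  have := congrArg (fun M : SO3 => M.1 0 0) h
  simp [rotZ, rotX] at this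
  linarith

/-- Here s and t stand for the half turns about z and x; allowing either to be 1 covers odd q or p,
so all presentations follow from one statement. -/
theorem injective_of_involutions (φ : Γ →* SO3) {a b : Γ} {p q : ℕ} (hp : p ≠ 0) (hq : q ≠ 0)
    (ha : φ a = genA p) (hb : φ b = genB q) (hab : Subgroup.closure {a, b} = ⊤)
    {s t : Γ} (hs : s * s = 1) (ht : t * t = 1) (hst : s * t = t * s)
    (hsa : s * a * s⁻¹ = a ∨ s * a * s⁻¹ = a⁻¹) (hsb : s * b = b * s)
    (hta : t * a = a * t) (htb : t * b * t⁻¹ = b ∨ t * b * t⁻¹ = b⁻¹)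
    (hφs : s = 1 ∨ φ s = rotZ π) (hφt : t = 1 ∨ φ t = rotX π)
    (hA : ∀ i : ℤ, (p : ℤ) ∣ 2 * i → ∃ k : ℤ, a ^ i = t ^ k)
    (hB : ∀ i : ℤ, (q : ℤ) ∣ 4 * i → ∃ k : ℤ, b ^ i = s ^ k) : Function.Injective φ := by
  have hta' : t * a * t⁻¹ = a ∨ t * a * t⁻¹ = a⁻¹ := .inl (mul_inv_eq_of_eq_mul hta)
  have hsb' : s * b * s⁻¹ = b ∨ s * b * s⁻¹ = b⁻¹ := .inl (mul_inv_eq_of_eq_mul hsb)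
  have hsabs : ∀ w i, |(φ s).1.mulVec w i| = |w i| := fun w i => by
    rcases hφs with rfl | h
    · simp
    · rw [h, abs_rotZ_pi_mulVec]
  have htabs : ∀ w i, |(φ t).1.mulVec w i| = |w i| := fun w i => by
    rcases hφt with rfl | h
    · simp
    · rw [h, abs_rotX_pi_mulVec]
  have hs1 : φ s = 1 → s = 1 := fun h => hφs.resolve_right fun h' => rotZ_pi_ne_one (h' ▸ h)
  have ht1 : φ t = 1 → t = 1 := fun h => hφt.resolve_right fun h' => rotX_pi_ne_one (h' ▸ h)
  refine injective_of_subgroup φ hp hq ha hb hab (kleinSubgroup s t hs ht hst) ?_ ?_ ?_ ?_ ?_ ?_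
  · rintro v (rfl | rfl | rfl | rfl)
    exacts [by simp, hsa, hta', conj_mul_eq_or hsa hta']
  · rintro v (rfl | rfl | rfl | rfl)
    exacts [by simp, hsb', htb, conj_mul_eq_or hsb' htb]
  · rintro v (rfl | rfl | rfl | rfl) w i
    · simp
    · exact hsabs w i
    · exact htabs w i
    · rw [← htabs w i, ← hsabs ((φ t).1.mulVec w) i, Matrix.mulVec_mulVec, map_mul]
      rfl
  · rintro v (rfl | rfl | rfl | rfl) h
    · rfl
    · exact hs1 h
    · exact ht1 h
    · rcases hφs with rfl | h1
      · rw [one_mul] at h ⊢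
        exact ht1 h
      rcases hφt with rfl | h2
      · rw [mul_one] at h ⊢
        exact hs1 h
      rw [map_mul, h1, h2] at h
      exact absurd h rotZ_pi_mul_rotX_pi_ne_one
  · intro i hi
    obtain ⟨k, hk⟩ := hA i hi
    rw [hk]
    exact Subgroup.zpow_mem _ (show t ∈ ({1, s, t, s * t} : Set Γ) by simp) k
  · intro i hi
    obtain ⟨k, hk⟩ := hB i hi
    rw [hk]
    exact Subgroup.zpow_mem _ (show s ∈ ({1, s, t, s * t} : Set Γ) by simp) k

end Injectivity

/-! ### The presentations in (i), (ii) and (iii). -/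

section Presentations

theorem exists_mulEquiv_G {Γ : Type*} [Group Γ] {p q : ℕ} (φ : Γ →* SO3) {a b : Γ}
    (ha : φ a = genA p) (hb : φ b = genB q) (hab : Subgroup.closure {a, b} = ⊤)
    (hφ : Function.Injective φ) :
    ∃ e : Γ ≃* G p q, (e a : SO3) = genA p ∧ (e b : SO3) = genB q := by
  have h : φ.range = G p q := by
    rw [MonoidHom.range_eq_map, ← hab, MonoidHom.map_closure, Set.image_pair, ha, hb, G]
  exact ⟨(MonoidHom.ofInjective hφ).trans (MulEquiv.subgroupCongr h), ha, hb⟩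

theorem closure_mk_pair (rels : Set (FreeGroup (Fin 2))) :
    Subgroup.closure {PresentedGroup.mk rels α, PresentedGroup.mk rels β} = ⊤ := by
  rw [← PresentedGroup.closure_range_of rels]
  congr 1
  ext x
  simp [PresentedGroup.of, α, β, eq_comm]

theorem lift_α (p q : ℕ) : FreeGroup.lift ![genA p, genB q] α = genA p := by simp [α]

theorem lift_β (p q : ℕ) : FreeGroup.lift ![genA p, genB q] β = genB q := by simp [β]

theorem hasPresentation_of_injective {p q : ℕ} {rels : Set (FreeGroup (Fin 2))}
    (hrels : ∀ r ∈ rels, FreeGroup.lift ![genA p, genB q] r = 1)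
    (hinj : ∀ φ : PresentedGroup rels →* SO3, φ (PresentedGroup.mk rels α) = genA p →
      φ (PresentedGroup.mk rels β) = genB q → Function.Injective φ) :
    HasPresentation p q rels := by
  have ha : PresentedGroup.toGroup hrels (PresentedGroup.mk rels α) = genA p :=
    lift_α p q
  have hb : PresentedGroup.toGroup hrels (PresentedGroup.mk rels β) = genB q :=
    lift_β p q
  exact exists_mulEquiv_G _ ha hb (closure_mk_pair rels) (hinj _ ha hb)

theorem zpow_eq_one_of_dvd {Γ : Type*} [Group Γ] {a : Γ} {n : ℕ} (ha : a ^ n = 1) {i : ℤ}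
    (h : (n : ℤ) ∣ i) : a ^ i = 1 := by
  obtain ⟨k, rfl⟩ := h
  rw [zpow_mul, zpow_natCast, ha, one_zpow]

theorem dvd_of_odd_dvd_two_mul {n : ℕ} (hn : Odd n) {i : ℤ} (h : (n : ℤ) ∣ 2 * i) :
    (n : ℤ) ∣ i := by
  refine IsCoprime.dvd_of_dvd_mul_left ?_ h
  exact Nat.isCoprime_iff_coprime.2 (Nat.coprime_two_right.2 hn)

theorem dvd_of_odd_dvd_four_mul {n : ℕ} (hn : Odd n) {i : ℤ} (h : (n : ℤ) ∣ 4 * i) :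
    (n : ℤ) ∣ i :=
  dvd_of_odd_dvd_two_mul hn (dvd_of_odd_dvd_two_mul hn (by rwa [← mul_assoc]))

theorem zpow_eq_zpow_of_dvd_two_mul {Γ : Type*} [Group Γ] (a : Γ) {n : ℕ} (hn : Even n) {i : ℤ}
    (h : (n : ℤ) ∣ 2 * i) : ∃ k : ℤ, a ^ i = (a ^ (n / 2)) ^ k := by
  obtain ⟨m, rfl⟩ := hn
  obtain ⟨k, hk⟩ := h
  refine ⟨k, ?_⟩
  rw [show (m + m) / 2 = m by omega, ← zpow_natCast a m, ← zpow_mul]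
  congr 1
  push_cast at hk
  linarith

theorem pow_half_mul_self {Γ : Type*} [Group Γ] {a : Γ} {n : ℕ} (hn : Even n) (ha : a ^ n = 1) :
    a ^ (n / 2) * a ^ (n / 2) = 1 := by
  obtain ⟨m, rfl⟩ := hn
  rw [show (m + m) / 2 = m by omega, ← pow_add, ha]

theorem conj_eq_inv_of_mul_eq_one {Γ : Type*} [Group Γ] {t b : Γ} (ht : t * t = 1)
    (h : t * b * t * b = 1) : t * b * t⁻¹ = b⁻¹ := by
  rw [inv_eq_of_mul_eq_one_left ht]
  exact eq_inv_of_mul_eq_one_left h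

theorem injective_of_odd_odd {Γ : Type*} [Group Γ] {p q : ℕ} (hp : Odd p) (hq : Odd q)
    (φ : Γ →* SO3) {a b : Γ} (ha : φ a = genA p) (hb : φ b = genB q)
    (hab : Subgroup.closure {a, b} = ⊤) (hap : a ^ p = 1) (hbq : b ^ q = 1) :
    Function.Injective φ := by
  refine injective_of_involutions φ hp.pos.ne' hq.pos.ne' ha hb hab (s := 1) (t := 1)
    (by simp) (by simp) (by simp) (by simp) (by simp) (by simp) (by simp) (by simp) (by simp)
    (fun i hi => ⟨0, ?_⟩) fun i hi => ⟨0, ?_⟩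
  · rw [zpow_eq_one_of_dvd hap (dvd_of_odd_dvd_two_mul hp hi), zpow_zero]
  · rw [zpow_eq_one_of_dvd hbq (dvd_of_odd_dvd_four_mul hq hi), zpow_zero]

theorem isFreeProduct_of_odd {p q : ℕ} (hp : Odd p) (hq : Odd q) : IsFreeProduct p q := by
  have hA : (zmultiplesHom (Additive SO3) (.ofMul (genA p))) p = 0 := by
    simp [← ofMul_pow, genA_pow_self hp.pos.ne']
  have hB : (zmultiplesHom (Additive SO3) (.ofMul (genB q))) q = 0 := by
    simp [← ofMul_pow, genB_pow_self hq.pos.ne']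
  set f : Multiplicative (ZMod p) →* SO3 := AddMonoidHom.toMultiplicativeLeft
    (ZMod.lift p ⟨_, hA⟩)
  set g : Multiplicative (ZMod q) →* SO3 := AddMonoidHom.toMultiplicativeLeft
    (ZMod.lift q ⟨_, hB⟩)
  have hgen : ∀ (n : ℕ) (x : Multiplicative (ZMod n)),
      x ∈ Subgroup.zpowers (Multiplicative.ofAdd (1 : ZMod n)) := fun n x =>
    ⟨(ZMod.cast x.toAdd : ℤ), by
      simp only [← ofAdd_zsmul, zsmul_one, ZMod.intCast_zmod_cast, ofAdd_toAdd]⟩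
  have hpow : ∀ n : ℕ, (Multiplicative.ofAdd (1 : ZMod n)) ^ n = 1 := fun n => by
    rw [← ofAdd_nsmul]; simp
  have ha : Monoid.Coprod.lift f g (Monoid.Coprod.inl (.ofAdd 1)) = genA p := by
    rw [Monoid.Coprod.lift_apply_inl]
    have h := congrArg Additive.toMul (ZMod.lift_coe p ⟨_, hA⟩ 1)
    rw [Int.cast_one, zmultiplesHom_apply, one_zsmul] at h
    exact h
  have hb : Monoid.Coprod.lift f g (Monoid.Coprod.inr (.ofAdd 1)) = genB q := by
    rw [Monoid.Coprod.lift_apply_inr]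
    have h := congrArg Additive.toMul (ZMod.lift_coe q ⟨_, hB⟩ 1)
    rw [Int.cast_one, zmultiplesHom_apply, one_zsmul] at h
    exact h
  have hab : Subgroup.closure {Monoid.Coprod.inl (Multiplicative.ofAdd (1 : ZMod p)),
      Monoid.Coprod.inr (Multiplicative.ofAdd (1 : ZMod q))} = ⊤ := by
    rw [eq_top_iff, ← Monoid.Coprod.closure_range_inl_union_inr, Subgroup.closure_le]
    rintro _ (⟨x, rfl⟩ | ⟨x, rfl⟩) <;> obtain ⟨k, rfl⟩ := hgen _ x <;>
      simp only [map_zpow] <;>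
      exact Subgroup.zpow_mem _ (Subgroup.subset_closure (by simp)) k
  exact exists_mulEquiv_G _ ha hb hab (injective_of_odd_odd hp hq _ ha hb hab
    (by rw [← map_pow, hpow, map_one]) (by rw [← map_pow, hpow, map_one]))

theorem hasPresentation_of_odd_odd {p q : ℕ} (hp : Odd p) (hq : Odd q) :
    HasPresentation p q (relsOdd p q) := by
  refine hasPresentation_of_injective ?_ fun φ ha hb => ?_
  · rintro r (rfl | rfl)
    · rw [map_pow, lift_α, genA_pow_self hp.pos.ne']
    · rw [map_pow, lift_β, genB_pow_self hq.pos.ne']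
  · refine injective_of_odd_odd hp hq φ ha hb (closure_mk_pair _) ?_ ?_ <;> rw [← map_pow] <;>
      exact PresentedGroup.one_of_mem (by simp [relsOdd])

theorem hasPresentation_of_even_odd {p q : ℕ} (hp0 : p ≠ 0) (hp : Even p) (hq : Odd q) :
    HasPresentation p q (relsEvenOdd p q) := by
  refine hasPresentation_of_injective ?_ fun φ ha hb => ?_
  · rintro r (rfl | rfl | rfl)
    · rw [map_pow, lift_α, genA_pow_self hp0]
    · rw [map_pow, lift_β, genB_pow_self hq.pos.ne']
    · simp only [map_mul, map_pow, lift_α, lift_β]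
      rw [genA_pow_half hp0 hp]
      exact rotX_pi_mul_rotZ _
  have hap : PresentedGroup.mk (relsEvenOdd p q) α ^ p = 1 := by
    rw [← map_pow]; exact PresentedGroup.one_of_mem (by simp [relsEvenOdd])
  have hbq : PresentedGroup.mk (relsEvenOdd p q) β ^ q = 1 := by
    rw [← map_pow]; exact PresentedGroup.one_of_mem (by simp [relsEvenOdd])
  have hab : PresentedGroup.mk (relsEvenOdd p q) (α ^ (p / 2) * β * α ^ (p / 2) * β) = 1 :=
    PresentedGroup.one_of_mem (by simp [relsEvenOdd])
  simp only [map_mul, map_pow] at hab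
  have htt := pow_half_mul_self hp hap
  refine injective_of_involutions φ hp0 hq.pos.ne' ha hb (closure_mk_pair _) (s := 1)
    (t := PresentedGroup.mk _ α ^ (p / 2)) (by simp) htt (by simp) (by simp) (by simp)
    (pow_mul_comm' _ _) (.inr (conj_eq_inv_of_mul_eq_one htt hab)) (.inl rfl)
    (.inr (by rw [map_pow, ha, genA_pow_half hp0 hp]))
    (fun i hi => zpow_eq_zpow_of_dvd_two_mul _ hp hi) fun i hi => ⟨0, ?_⟩
  rw [zpow_eq_one_of_dvd hbq (dvd_of_odd_dvd_four_mul hq hi), zpow_zero]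

theorem hasPresentation_of_even_even {p s : ℕ} (hp0 : p ≠ 0) (hp : Even p) (hs : Odd s) :
    HasPresentation p (2 * s) (relsEvenEven p (2 * s)) := by
  have hq0 : 2 * s ≠ 0 := mul_ne_zero two_ne_zero hs.pos.ne'
  have hq : Even (2 * s) := even_two_mul s
  set q := 2 * s with hqs
  refine hasPresentation_of_injective ?_ fun φ ha hb => ?_
  · rintro r (rfl | rfl | rfl | rfl)
    · rw [map_pow, lift_α, genA_pow_self hp0]
    · rw [map_pow, lift_β, genB_pow_self hq0]
    · simp only [map_mul, map_pow, lift_α, lift_β]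
      rw [genA_pow_half hp0 hp]
      exact rotX_pi_mul_rotZ _
    · simp only [map_mul, map_pow, lift_α, lift_β]
      rw [genB_pow_half hq0 hq]
      exact rotZ_pi_mul_rotX _
  have hap : PresentedGroup.mk (relsEvenEven p q) α ^ p = 1 := by
    rw [← map_pow]; exact PresentedGroup.one_of_mem (by simp [relsEvenEven])
  have hbq : PresentedGroup.mk (relsEvenEven p q) β ^ q = 1 := by
    rw [← map_pow]; exact PresentedGroup.one_of_mem (by simp [relsEvenEven])
  have hab : PresentedGroup.mk (relsEvenEven p q) (α ^ (p / 2) * β * α ^ (p / 2) * β) = 1 :=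
    PresentedGroup.one_of_mem (by simp [relsEvenEven])
  have hba : PresentedGroup.mk (relsEvenEven p q) (β ^ (q / 2) * α * β ^ (q / 2) * α) = 1 :=
    PresentedGroup.one_of_mem (by simp [relsEvenEven])
  simp only [map_mul, map_pow] at hab hba
  have htt := pow_half_mul_self hp hap
  have hss := pow_half_mul_self hq hbq
  have hsa := conj_eq_inv_of_mul_eq_one hss hba
  have hst : PresentedGroup.mk (relsEvenEven p q) β ^ (q / 2) *
      PresentedGroup.mk (relsEvenEven p q) α ^ (p / 2) =
      PresentedGroup.mk (relsEvenEven p q) α ^ (p / 2) *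
      PresentedGroup.mk (relsEvenEven p q) β ^ (q / 2) := by
    -- β^(q/2) inverts α, hence fixes the involution α^(p/2).
    rw [← mul_inv_eq_iff_eq_mul, ← conj_pow, hsa, inv_pow]
    exact inv_eq_of_mul_eq_one_left htt
  refine injective_of_involutions φ hp0 hq0 ha hb (closure_mk_pair _)
    (s := PresentedGroup.mk _ β ^ (q / 2)) (t := PresentedGroup.mk _ α ^ (p / 2)) hss htt hst
    (.inr hsa) (pow_mul_comm' _ _) (pow_mul_comm' _ _)
    (.inr (conj_eq_inv_of_mul_eq_one htt hab))
    (.inr (by rw [map_pow, hb, genB_pow_half hq0 hq]))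
    (.inr (by rw [map_pow, ha, genA_pow_half hp0 hp]))
    (fun i hi => zpow_eq_zpow_of_dvd_two_mul _ hp hi)
    fun i hi => zpow_eq_zpow_of_dvd_two_mul _ hq ?_
  -- Oddness of s excludes quarter turns about z: 2s ∣ 4i forces s ∣ i, hence 2s ∣ 2i.
  have h : (s : ℤ) ∣ 2 * i := by
    obtain ⟨k, hk⟩ := hi
    rw [hqs] at hk
    push_cast at hk
    exact ⟨k, by linarith⟩
  rw [hqs]
  push_cast
  exact mul_dvd_mul_left 2 (dvd_of_odd_dvd_two_mul hs h)

end Presentations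

/-! ### Quarter turns and the equality in (iv). -/

section QuarterTurns

theorem genB_one : genB 1 = 1 := by
  rw [genB, Nat.cast_one, div_one, rotZ_two_pi]

theorem rotY_quarter_conj_rotX (θ : ℝ) :
    (rotY (π / 2))⁻¹ * rotX θ * rotY (π / 2) = rotZ θ := by
  rw [mul_assoc, inv_mul_eq_iff_eq_mul]
  apply Subtype.ext
  ext i j
  fin_cases i <;> fin_cases j <;> simp [rotX, rotY, rotZ]

theorem rotX_quarter_conj_rotZ (θ : ℝ) :
    (rotX (π / 2))⁻¹ * rotZ θ * rotX (π / 2) = rotY θ := by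
  rw [mul_assoc, inv_mul_eq_iff_eq_mul]
  apply Subtype.ext
  ext i j
  fin_cases i <;> fin_cases j <;> simp [rotX, rotY, rotZ]

theorem genA_pow_of_dvd {p m : ℕ} (hp : 0 < p) (h : m ∣ p) : genA p ^ (p / m) = genA m := by
  obtain ⟨k, rfl⟩ := h
  have hm : 0 < m := Nat.pos_of_mul_pos_right hp
  have hk : 0 < k := Nat.pos_of_mul_pos_left hp
  rw [Nat.mul_div_cancel_left _ hm, ← zpow_natCast, genA_zpow, genA]
  congr 1
  push_cast
  field_simp

theorem genB_pow_of_dvd {p m : ℕ} (hp : 0 < p) (h : m ∣ p) : genB p ^ (p / m) = genB m := by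
  obtain ⟨k, rfl⟩ := h
  have hm : 0 < m := Nat.pos_of_mul_pos_right hp
  have hk : 0 < k := Nat.pos_of_mul_pos_left hp
  rw [Nat.mul_div_cancel_left _ hm, ← zpow_natCast, genB_zpow, genB]
  congr 1
  push_cast
  field_simp

/-- Bézout divided by pq: if gcd = px + qy, then 1/lcm = gcd/(pq) = x/q + y/p. -/
theorem genA_lcm {p q : ℕ} (hp : 0 < p) (hq : 0 < q) :
    genA (p.lcm q) = genA p ^ (p.gcdB q) * genA q ^ (p.gcdA q) := by
  rw [genA_zpow, genA_zpow, ← rotX_add, genA]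
  congr 1
  have h1 : (p.gcd q : ℝ) = p * p.gcdA q + q * p.gcdB q := by
    exact_mod_cast Nat.gcd_eq_gcd_ab p q
  have h2 : (p.gcd q : ℝ) * p.lcm q = p * q := by exact_mod_cast Nat.gcd_mul_lcm p q
  have h3 : (p.lcm q : ℝ) ≠ 0 := by exact_mod_cast (Nat.lcm_pos hp hq).ne'
  field_simp
  rw [← h2, h1]
  ring

theorem genA_four : genA 4 = rotX (π / 2) := by
  rw [genA]; congr 1; push_cast; ring

theorem genB_four : genB 4 = rotZ (π / 2) := by
  rw [genB]; congr 1; push_cast; ring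

theorem genL_four : genL 4 = rotY (π / 2) := by
  rw [genL]; congr 1; push_cast; ring

theorem G3_eq_of_four_dvd {p q : ℕ} (hp : 0 < p) (hq : 0 < q) (hp4 : 4 ∣ p) (hq4 : 4 ∣ q) :
    G3 p 1 q = G3 (p.lcm q) 4 1 := by
  have hl := Nat.lcm_pos hp hq
  rw [G3_one]
  apply le_antisymm
  · have hA : genA (p.lcm q) ∈ G3 (p.lcm q) 4 1 := Subgroup.subset_closure (by simp)
    have hL : rotY (π / 2) ∈ G3 (p.lcm q) 4 1 :=
      Subgroup.subset_closure (by simp [genL_four])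
    rw [G, Subgroup.closure_le]
    rintro _ (rfl | rfl)
    · rw [← genA_pow_of_dvd hl (Nat.dvd_lcm_left p q)]
      exact Subgroup.pow_mem _ hA _
    · have h : genA q ∈ G3 (p.lcm q) 4 1 := by
        rw [← genA_pow_of_dvd hl (Nat.dvd_lcm_right p q)]
        exact Subgroup.pow_mem _ hA _
      rw [genB, ← rotY_quarter_conj_rotX]
      exact mul_mem (mul_mem (inv_mem hL) h) hL
  · have hA : genA p ∈ G p q := Subgroup.subset_closure (by simp)
    have hB : genB q ∈ G p q := Subgroup.subset_closure (by simp)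
    have hX : rotX (π / 2) ∈ G p q := by
      rw [← genA_four, ← genA_pow_of_dvd hp hp4]
      exact Subgroup.pow_mem _ hA _
    have hZ : rotZ (π / 2) ∈ G p q := by
      rw [← genB_four, ← genB_pow_of_dvd hq hq4]
      exact Subgroup.pow_mem _ hB _
    have hL : rotY (π / 2) ∈ G p q := by
      rw [← rotX_quarter_conj_rotZ]
      exact mul_mem (mul_mem (inv_mem hX) hZ) hX
    -- Conjugating B by the quarter turn about y moves its axis to x, so Bézout can combine both
    -- angles about one axis.
    have hAq : genA q ∈ G p q := by
      have h : rotY (π / 2) * genB q * (rotY (π / 2))⁻¹ = genA q := by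
        rw [genB, ← rotY_quarter_conj_rotX, genA]
        group
      rw [← h]
      exact mul_mem (mul_mem hL hB) (inv_mem hL)
    rw [G3, Subgroup.closure_le]
    rintro _ (rfl | rfl | rfl)
    · rw [genA_lcm hp hq]
      exact mul_mem (Subgroup.zpow_mem _ hA _) (Subgroup.zpow_mem _ hAq _)
    · rw [genL_four]
      exact hL
    · rw [genB_one]
      exact one_mem _

end QuarterTurns
end RotGroup

theorem theorem1 :
    -- (i)
    (∀ p q : ℕ, 3 ≤ p → 3 ≤ q → Odd p → Odd q →
      RotGroup.IsFreeProduct p q ∧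
      RotGroup.HasPresentation p q (RotGroup.relsOdd p q)) ∧
    -- (ii)
    (∀ p q : ℕ, 4 ≤ p → Even p → 3 ≤ q → Odd q →
      RotGroup.HasPresentation p q (RotGroup.relsEvenOdd p q)) ∧
    -- (iii)
    (∀ p q s : ℕ, 4 ≤ p → Even p → q = 2 * s → 3 ≤ s → Odd s →
      RotGroup.HasPresentation p q (RotGroup.relsEvenEven p q)) ∧
    -- (iv)
    (∀ p q : ℕ, 0 < p → 0 < q → 4 ∣ p → 4 ∣ q →
      RotGroup.G3 p 1 q = RotGroup.G3 (Nat.lcm p q) 4 1) := by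
  refine ⟨fun p q _ _ hp hq => ⟨RotGroup.isFreeProduct_of_odd hp hq,
    RotGroup.hasPresentation_of_odd_odd hp hq⟩, fun p q hp4 hp _ hq =>
    RotGroup.hasPresentation_of_even_odd (by omega) hp hq, ?_, fun p q hp hq hp4 hq4 =>
    RotGroup.G3_eq_of_four_dvd hp hq hp4 hq4⟩
  rintro p q s hp4 hp rfl - hs
  exact RotGroup.hasPresentation_of_even_even (by omega) hp hs
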